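/- **Model.** Time is discrete (all time quantities are integers). There are $n$ independent sporadic weakly-hard tasks $\tau_i=(C_i,D_i,T_i,m_i,K_i)$ with worst-case execution time $C_i\ge 1$, relative deadline $1\le D_i\le T_i$, minimum inter-arrival time $T_i$, and $1\le m_i<K_i$ ($m_i$ tolerable deadline misses in any $K_i$ consecutive jobs). They are listed in ascending order of $D_i$, ties by ascending $m_i$, remaining ties arbitrarily. Put $$w_i=\max\Big(\Big\lfloor\tfrac{m_i}{K_i-m_i}\Big\rfloor,1\Big),\qquad h_i=\Big\lceil\tfrac{K_i-m_i}{m_i}\Big\rceil .$$ Call $\tau_i$ high-tolerance if $m_i/K_i\ge 1/2$, and low-tolerance otherwise. Task $\tau_i$ has the job-classes $\mathcal{JC}^q_i$, $0\le q\le K_i-m_i$. Pairwise distinct priorities are assigned, from the highest to the lowest, by going through $q=0,1,2,\dots$ and, for each $q$, through the tasks that have a class $q$ in the order of the list. Let $hp(k)$ be the set of $i$ such that $\mathcal{JC}^0_i$ has a higher priority than $\mathcal{JC}^0_k$. A job of $\tau_i$ released when the job-level of $\tau_i$ is $jl_i$ belongs to $\mathcal{JC}^q_i$ with $q=\max(0,jl_i)$.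 Initially $jl_i=-(h_i-1)$. Each deadline hit increases $jl_i$ by one, up to $K_i-m_i$. When $w_i$ deadline misses have happened since the start or the last restoration, $jl_i$ is restored to $-(h_i-1)$ (the result holds both if these misses are counted cumulatively and if only consecutive misses are counted). A job that has not completed by its absolute deadline is killed. At each time the (at most $n_c$) pending jobs of highest priority execute on $n_c\ge 1$ identical cores, with free preemption and migration, each job on at most one core at a time. Every job of $\tau_i$ needs at most $C_i$ time units of execution. **Analysis.** Given $R^{ub}_i$, let $s_i=\max(D_i-R^{ub}_i,0)$ and, for an interval length $L$, $X_i(L)=L+D_i-C_i-s_i$. Let $T_i'=(w_i+1)T_i$ if $\tau_i$ is high-tolerance and $T_i'=T_i$ if it is low-tolerance, and let $N_i(L)=\lfloor X_i(L)/T_i'\rfloor$. For high-tolerance tasks put $O_i(L)=0$ and $a_i=1$; for low-tolerance tasks put $$O_i(L)=\Big\lfloor\frac{X_i(L)}{T_i(h_i+1)}\Big\rfloor,\qquad a_i=1-\Big\lfloor\frac{N_i(L)\bmod(h_i+1)}{h_i}\Big\rfloor .$$ Let $$\hat W_i(L)=(N_i(L)-O_i(L))\,C_i+a_i\min\big(C_i,\;X_i(L)\bmod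 T_i'\big).$$ $R^{ub}_k$ is the fixed point reached, if one is reached, by the following iteration started with $R^{ub}_k=C_k$, the tasks being treated in the order of their priorities: $$R^{ub}_k\leftarrow C_k+\Big\lfloor\frac1{n_c}\sum_{i\in hp(k)}\min\big(\hat W_i(R^{ub}_k),\,R^{ub}_k-C_k+1\big)\Big\rfloor .$$ **Claim.** Suppose that the iterations for $\tau_k$ and for all $\tau_i$ with $i\in hp(k)$ reach fixed points, and that $R^{ub}_i\le D_i$ for all $i\in hp(k)$. Then $R^{ub}_k$ is a safe upper bound on the response time of the jobs of $\tau_k$ in $\mathcal{JC}^0_k$: in every schedule produced by the above algorithm, each such job that completes does so at most $R^{ub}_k$ time units after its release, and if $R^{ub}_k\le D_k$, then every such job completes (it is not killed). -/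

import Mathlib

namespace WeaklyHard

/-- A sporadic weakly-hard task with constrained deadline: worst-case execution time `C`, relative
deadline `D`, minimum inter-arrival time `T`, and at most `m` tolerable deadline misses in any
window of `K` consecutive jobs. All time parameters are integers (discrete time). -/
structure WHTask where
  C : ℕ
  D : ℕ
  T : ℕ
  m : ℕ
  K : ℕ
  C_pos : 0 < C
  D_pos : 0 < D
  D_le_T : D ≤ T
  one_le_m : 1 ≤ m
  m_lt_K : m < K

namespace WHTask

/-- High-tolerance tasks: `m / K ≥ 1/2`. The other (weakly-hard) tasks are low-tolerance. -/
def HighTolerance (τ : WHTask) : Prop := (1 / 2 : ℚ) ≤ (τ.m : ℚ) / (τ.K : ℚ)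

instance (τ : WHTask) : Decidable τ.HighTolerance :=
  inferInstanceAs (Decidable ((1 / 2 : ℚ) ≤ (τ.m : ℚ) / (τ.K : ℚ)))

/-- `w = max (⌊m / (K - m)⌋) 1`. -/
def w (τ : WHTask) : ℕ := max ⌊(τ.m : ℚ) / ((τ.K : ℚ) - (τ.m : ℚ))⌋₊ 1

/-- `h = ⌈(K - m) / m⌉`. -/
def h (τ : WHTask) : ℕ := ⌈((τ.K : ℚ) - (τ.m : ℚ)) / (τ.m : ℚ)⌉₊

/-- The number of job-classes of the task; the classes are `q = 0, …, K - m`. -/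
def numClasses (τ : WHTask) : ℕ := τ.K - τ.m + 1

/-! ### Workload bound

In the following functions `R` is the response-time bound of the task `τ` and `L` is the length of
the interval of interest. Everything is computed in `ℤ`, where `/` and `%` with a positive
divisor are the floor of the quotient and the nonnegative remainder. -/

/-- The slack `s = max (D - R) 0`. -/
def slack (τ : WHTask) (R : ℤ) : ℤ := max ((τ.D : ℤ) - R) 0

/-- The length `L + D - C - s` from which the jobs in the interval are counted. -/
def span (τ : WHTask) (R L : ℤ) : ℤ := L + (τ.D : ℤ) - (τ.C : ℤ) - τ.slack R

/-- The period used in the analysis: `(w + 1) T` for high-tolerance tasks, `T` otherwise. -/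
def period (τ : WHTask) : ℤ :=
  if τ.HighTolerance then ((τ.w : ℤ) + 1) * (τ.T : ℤ) else (τ.T : ℤ)

/-- `N(L)`: the number of carry-in and body jobs. -/
def N (τ : WHTask) (R L : ℤ) : ℤ := τ.span R L / τ.period

/-- `O(L)`: the number of those jobs that are certainly not in the top class. -/
def O (τ : WHTask) (R L : ℤ) : ℤ :=
  if τ.HighTolerance then 0 else τ.span R L / ((τ.T : ℤ) * ((τ.h : ℤ) + 1))

/-- `a`: the indicator that the carry-out job is counted. -/
def a (τ : WHTask) (R L : ℤ) : ℤ :=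
  if τ.HighTolerance then 1 else 1 - (τ.N R L % ((τ.h : ℤ) + 1)) / (τ.h : ℤ)

/-- The bound on the top-class workload of the task in an interval of length `L`. -/
def workload (τ : WHTask) (R L : ℤ) : ℤ :=
  (τ.N R L - τ.O R L) * (τ.C : ℤ) + τ.a R L * min (τ.C : ℤ) (τ.span R L % τ.period)

/-- The pair (job-level, number of counted misses) at the release of the `j`-th job, where
`hit j'` says that the `j'`-th job met its deadline. The job-level starts at `-(h - 1)`, is
increased by one (up to `K - m`) at each deadline hit and is restored to `-(h - 1)` as soon as `w`
deadline misses happened. The misses are counted from the last restoration on; if `consec = true`,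
only consecutive misses are counted, that is, a hit also resets the count. -/
def levelState (τ : WHTask) (consec : Bool) (hit : ℕ → Prop) [DecidablePred hit] : ℕ → ℤ × ℕ
  | 0 => (-((τ.h : ℤ) - 1), 0)
  | j + 1 =>
    let s := levelState τ consec hit j
    if hit j then
      (min (s.1 + 1) ((τ.K : ℤ) - (τ.m : ℤ)), if consec then 0 else s.2)
    else if τ.w ≤ s.2 + 1 then
      (-((τ.h : ℤ) - 1), 0)
    else
      (s.1, s.2 + 1)

end WHTask

/-- A set of `n` tasks, listed in ascending order of deadlines, where tasks with equal deadlines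
are listed in ascending order of `m` (and remaining ties in any order). -/
structure TaskSet (n : ℕ) where
  task : Fin n → WHTask
  sorted : ∀ i j : Fin n, i < j →
    (task i).D < (task j).D ∨ ((task i).D = (task j).D ∧ (task i).m ≤ (task j).m)

namespace TaskSet

variable {n : ℕ}

/-- The priority of the class `q` of task `i` (larger is more urgent). The classes
are visited with `q = 0, 1, 2, …` and, for each `q`, through the tasks that have a class `q`, in the
order of the list; the first one gets the total number of classes as its priority,
and each later one gets the next smaller value. -/
def classPriority (S : TaskSet n) (i : Fin n) (q : ℕ) : ℕ :=
  (∑ j, (S.task j).numClasses) -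
    ∑ j, ((Finset.range (S.task j).numClasses).filter (fun p => p < q ∨ (p = q ∧ j < i))).card

/-- The tasks whose top class has a higher priority than the top class of task `k`. -/
def hp (S : TaskSet n) (k : Fin n) : Finset (Fin n) :=
  Finset.univ.filter (fun i => S.classPriority k 0 < S.classPriority i 0)

/-- The right-hand side of the fixed-point iteration for task `k` on `nc` cores, given the bounds
`R i` of the tasks `i ∈ hp k`. -/
def rtaStep (S : TaskSet n) (nc : ℕ) (R : Fin n → ℤ) (k : Fin n) (x : ℤ) : ℤ :=
  ((S.task k).C : ℤ) +
    (∑ i ∈ S.hp k, min ((S.task i).workload (R i) x) (x - ((S.task k).C : ℤ) + 1)) / (nc : ℤ)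

/-- The fixed-point iteration for task `k`, started with `C_k`, stops at the value `R k`. -/
def IsRub (S : TaskSet n) (nc : ℕ) (R : Fin n → ℤ) (k : Fin n) : Prop :=
  (∃ l : ℕ, (S.rtaStep nc R k)^[l] ((S.task k).C : ℤ) = R k) ∧ S.rtaStep nc R k (R k) = R k

end TaskSet

/-- A behaviour of the environment: task `i` releases the jobs `j = 0, 1, …` with `j < count i`
(finitely or infinitely many), consecutive releases are at least `T` apart, and the `j`-th
job needs `cost i j ≤ C` time units of execution. -/
structure Arrivals {n : ℕ} (S : TaskSet n) where
  count : Fin n → ℕ∞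
  release : Fin n → ℕ → ℕ
  cost : Fin n → ℕ → ℕ
  separated : ∀ (i : Fin n) (j : ℕ), ((j + 1 : ℕ) : ℕ∞) < count i →
    release i j + (S.task i).T ≤ release i (j + 1)
  cost_le : ∀ (i : Fin n) (j : ℕ), cost i j ≤ (S.task i).C

namespace Arrivals

variable {n : ℕ} {S : TaskSet n}

/-! In the following definitions `σ t` is the set of the jobs (pairs of a task and a job index) that
execute during the time slot `[t, t + 1)`, each of them on one core. -/

/-- The execution time that the `j`-th job of task `i` has received up to time `t`. -/
def service (σ : ℕ → Finset (Fin n × ℕ)) (i : Fin n) (j t : ℕ) : ℕ :=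
  ((Finset.range t).filter (fun s => (i, j) ∈ σ s)).card

/-- The job meets its deadline. -/
def Hit (A : Arrivals S) (σ : ℕ → Finset (Fin n × ℕ)) (i : Fin n) (j : ℕ) : Prop :=
  A.cost i j ≤ service σ i j (A.release i j + (S.task i).D)

/-- The job is pending at time `t`: it has been released, it is not completed, and it has not been
killed at its deadline. -/
def Pending (A : Arrivals S) (σ : ℕ → Finset (Fin n × ℕ)) (i : Fin n) (j t : ℕ) : Prop :=
  (j : ℕ∞) < A.count i ∧ A.release i j ≤ t ∧ t < A.release i j + (S.task i).D ∧
    service σ i j t < A.cost i j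

open Classical in
/-- The index `q = max 0 jl` of the class to which the `j`-th job of task `i` is assigned. -/
noncomputable def jobClass (A : Arrivals S) (consec : Bool) (σ : ℕ → Finset (Fin n × ℕ))
    (i : Fin n) (j : ℕ) : ℕ :=
  (max 0 ((S.task i).levelState consec (A.Hit σ i) j).1).toNat

/-- `σ` is the preemptive global schedule on `nc` cores in which the pending jobs with the highest
class priorities execute at each time. -/
structure IsSchedule (A : Arrivals S) (nc : ℕ) (consec : Bool)
    (σ : ℕ → Finset (Fin n × ℕ)) : Prop where
  pending : ∀ (t : ℕ) (i : Fin n) (j : ℕ), (i, j) ∈ σ t → A.Pending σ i j t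
  card_le : ∀ t : ℕ, (σ t).card ≤ nc
  priority : ∀ (t : ℕ) (i : Fin n) (j : ℕ), A.Pending σ i j t → (i, j) ∉ σ t →
    (σ t).card = nc ∧ ∀ (i' : Fin n) (j' : ℕ), (i', j') ∈ σ t →
      S.classPriority i (A.jobClass consec σ i j) < S.classPriority i' (A.jobClass consec σ i' j')

/-- The response time of the job is `ρ`: its execution is completed `ρ` time units
after its release and not earlier. A job that is killed before completion has no response time. -/
def HasResponseTime (A : Arrivals S) (σ : ℕ → Finset (Fin n × ℕ)) (i : Fin n) (j ρ : ℕ) : Prop :=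
  IsLeast {x : ℕ | A.cost i j ≤ service σ i j (A.release i j + x)} ρ

end Arrivals

end WeaklyHard

/-! The proof is by induction along the priority order. Since `R i ≤ D` for every `i ∈ hp k`, the
induction hypothesis makes all released top-class jobs of these tasks meet their deadlines. This
forces a pattern on the job-levels: a low-tolerance task has at most `h` consecutive top-class jobs
(`exists_level_pos`), and in a high-tolerance task each top-class job is followed by `w` jobs
outside the top class (`level_pos_of_level_nonpos`).

The pattern limits the top-class jobs that execute in a window. All but the first and last
contribute at most `C` each; those two are limited jointly by the window length, the response bound
and the release separation. Optimising gives the workload formula (`workload_arith`,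
`card_busy_le_workload`).

If a top-class job of `k` were unfinished after `x = R k ≤ D` units, then in at least `x - C + 1`
slots it would wait while all `nc` cores serve top-class jobs of distinct tasks in `hp k`. Double
counting (`mul_le_sum_of_service_lt`) makes the right-hand side of the iteration exceed `x`,
contradicting the fixed point. If `R k > D`, the bound is trivial because of killing. -/

namespace WeaklyHard

/-! ### Job-level dynamics when top-class jobs meet their deadlines -/

namespace WHTask

theorem h_le_one_of_highTolerance (τ : WHTask) (ht : τ.HighTolerance) : τ.h ≤ 1 := by
  have hm : (0 : ℚ) < τ.m := by exact_mod_cast τ.one_le_m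
  have hK : (0 : ℚ) < τ.K := by exact_mod_cast τ.one_le_m.trans_lt τ.m_lt_K |>.trans' one_pos
  unfold HighTolerance at ht
  rw [le_div_iff₀ hK] at ht
  unfold h
  rw [Nat.ceil_le, div_le_iff₀ hm]
  push_cast
  linarith

theorem h_pos (τ : WHTask) : 0 < τ.h := by
  have hm : (0 : ℚ) < τ.m := by exact_mod_cast τ.one_le_m
  have hmK : (τ.m : ℚ) < τ.K := by exact_mod_cast τ.m_lt_K
  exact Nat.ceil_pos.2 (div_pos (by linarith) hm)

section Levels

variable (τ : WHTask) (consec : Bool) (hit : ℕ → Prop) [DecidablePred hit]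

theorem le_level (j : ℕ) : -((τ.h : ℤ) - 1) ≤ (τ.levelState consec hit j).1 := by
  have := τ.m_lt_K
  induction j with
  | zero => simp [levelState]
  | succ j ih =>
    simp only [levelState]
    split_ifs <;> simp only <;> omega

theorem level_add_le_of_hits {j d : ℕ}
    (H : ∀ l, j ≤ l → l < j + d → hit l ∧ (τ.levelState consec hit l).1 ≤ 0) :
    (τ.levelState consec hit j).1 + d ≤ (τ.levelState consec hit (j + d)).1 := by
  have := τ.m_lt_K
  induction d with
  | zero => simp
  | succ d ih =>
    have h1 := ih fun l hl hl' => H l hl (by omega)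
    obtain ⟨h2, h3⟩ := H (j + d) (by omega) (by omega)
    rw [← Nat.add_assoc]
    simp only [levelState, h2, if_true]
    push_cast
    omega

/-- If all jobs of the top class meet their deadlines, then at most `h` consecutive jobs are in the
top class. -/
theorem exists_level_pos {j : ℕ}
    (H : ∀ l, j ≤ l → l ≤ j + τ.h → (τ.levelState consec hit l).1 ≤ 0 → hit l) :
    ∃ l, j ≤ l ∧ l ≤ j + τ.h ∧ 0 < (τ.levelState consec hit l).1 := by
  by_contra! hc
  -- From a level of at least `-(h - 1)`, `h` hits in a row lead to level at least `1`.
  have h1 := τ.level_add_le_of_hits consec hit (j := j) (d := τ.h)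
    fun l hl hl' => ⟨H l hl (by omega) (hc l hl (by omega)), hc l hl (by omega)⟩
  have h2 := hc (j + τ.h) (by omega) le_rfl
  have h3 := τ.le_level consec hit j
  omega

/-- With `h ≤ 1` a top-class hit leaves the top class at once, and a top-class miss is excluded. So
the level is nonpositive only initially or just after a restoration, where the count is zero under
both counting rules. -/
theorem misses_eq_zero_of_level_nonpos (hh : τ.h ≤ 1) {j : ℕ}
    (H : ∀ l < j, (τ.levelState consec hit l).1 ≤ 0 → hit l)
    (hj : (τ.levelState consec hit j).1 ≤ 0) : (τ.levelState consec hit j).2 = 0 := by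
  have := τ.m_lt_K
  cases j with
  | zero => simp [levelState]
  | succ j =>
    have h1 := τ.le_level consec hit j
    have h2 := H j (by omega)
    simp only [levelState] at hj ⊢
    split_ifs at hj ⊢ with h3 h4 h4
    · rfl
    · simp only at hj; omega
    · rfl
    · exact absurd (h2 hj) h3

/-- If all jobs of the top class of a high-tolerance task meet their deadlines, then each of them is
followed by at least `w` jobs that are not in the top class. -/
theorem level_pos_of_level_nonpos (hh : τ.h ≤ 1) {j d : ℕ}
    (H : ∀ l ≤ j, (τ.levelState consec hit l).1 ≤ 0 → hit l)
    (hj : (τ.levelState consec hit j).1 ≤ 0) (hd : d < τ.w) :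
    0 < (τ.levelState consec hit (j + 1 + d)).1 ∧
      (τ.levelState consec hit (j + 1 + d)).2 ≤ d := by
  have := τ.m_lt_K
  induction d with
  | zero =>
    have h1 := τ.le_level consec hit j
    have h2 := τ.misses_eq_zero_of_level_nonpos consec hit hh (fun l hl => H l hl.le) hj
    simp only [levelState, H j le_rfl hj, if_true]
    refine ⟨by omega, ?_⟩
    split_ifs <;> omega
  | succ d ih =>
    obtain ⟨h1, h2⟩ := ih (by omega)
    rw [← Nat.add_assoc]
    simp only [levelState]
    split_ifs with h3 h4 h5 <;> refine ⟨?_, ?_⟩ <;> simp only <;> omega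

end Levels

end WHTask

/-! ### Counting and arithmetic behind the workload bound -/

/-- Cut off blocks of length `h + 1`; each full block loses at least one index. -/
theorem card_filter_Ico_le_of_exists_not (P : ℕ → Prop) [DecidablePred P] (h : ℕ) (b : ℕ)
    (H : ∀ j, j + h < b → ∃ l, j ≤ l ∧ l ≤ j + h ∧ ¬ P l) (p : ℕ) :
    ∀ a, a + p = b → ((Finset.Ico a b).filter P).card + p / (h + 1) ≤ p := by
  induction p using Nat.strong_induction_on with
  | _ p ih =>
    intro a ha
    rcases Nat.lt_or_ge p (h + 1) with hp | hp
    · rw [Nat.div_eq_of_lt hp]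
      refine (Finset.card_filter_le (Finset.Ico a b) P).trans ?_
      simp; omega
    · have h1 := ih (p - (h + 1)) (by omega) (a + (h + 1)) (by omega)
      have h2 : p / (h + 1) = (p - (h + 1)) / (h + 1) + 1 := by
        rw [← Nat.add_div_right _ (Nat.succ_pos h)]; congr 1; omega
      obtain ⟨l, hl1, hl2, hl3⟩ := H a (by omega)
      have h3 : ((Finset.Ico a (a + (h + 1))).filter P).card < h + 1 := by
        have : ((Finset.Ico a (a + (h + 1))).filter P).card < (Finset.Ico a (a + (h + 1))).card :=
          Finset.card_lt_card (Finset.filter_ssubset.2 ⟨l, by simp; omega, hl3⟩)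
        simpa using this
      have h4 : (Finset.Ico a b).filter P =
          (Finset.Ico a (a + (h + 1))).filter P ∪ (Finset.Ico (a + (h + 1)) b).filter P := by
        rw [← Finset.filter_union, Finset.Ico_union_Ico_eq_Ico (by omega) (by omega)]
      have h5 := Finset.card_union_le ((Finset.Ico a (a + (h + 1))).filter P)
        ((Finset.Ico (a + (h + 1)) b).filter P)
      rw [h4]
      omega

theorem card_mul_add_le_of_separated (g : ℕ) (J : Finset ℕ)
    (sep : ∀ x ∈ J, ∀ y ∈ J, x < y → x + g ≤ y) (lo : ℕ) (hlo : ∀ x ∈ J, lo ≤ x) :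
    ∀ y, (∀ x ∈ J, x < y → x + g ≤ y) → (∀ x ∈ J, x < y) → lo ≤ y → J.card * g + lo ≤ y := by
  induction J using Finset.induction_on_max with
  | empty => simp
  | insert a s ha ih =>
    intro y hy hy' hly
    have h1 : a ∉ s := fun h => lt_irrefl _ (ha a h)
    have h2 := ih (fun x hx z hz => sep x (by simp [hx]) z (by simp [hz]))
      (fun x hx => hlo x (by simp [hx])) a (fun x hx => sep x (by simp [hx]) a (by simp)) ha
      (hlo a (by simp))
    have h3 := hy a (by simp) (hy' a (by simp))
    rw [Finset.card_insert_of_notMem h1]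
    linarith [Nat.succ_mul s.card g]

/-- The workload of at most `f p` jobs with periods `P` between the first and the last one. -/
theorem workload_arith {f : ℤ → ℤ} (f0 : f 0 = 0) (f1 : f 1 = 1) (fmono : ∀ n, f n ≤ f (n + 1))
    (fstep : ∀ n, f (n + 1) ≤ f n + 1) {C P R L : ℤ} (hC : 0 < C) (hCP : C ≤ P) (hCR : C ≤ R)
    (hL : 0 ≤ L) {total : ℤ}
    (htot : total ≤ 0 ∨ (total ≤ C ∧ total ≤ L) ∨ ∃ cnt p c₁ c₂ : ℤ,
      total ≤ (cnt - 2) * C + c₁ + c₂ ∧ cnt ≤ f p ∧ 0 < c₁ ∧ 0 < c₂ ∧ c₁ ≤ C ∧ c₂ ≤ C ∧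
      c₁ + c₂ ≤ L + R - (p - 1) * P) :
    total ≤ f ((L + R - C) / P) * C +
      (f ((L + R - C) / P + 1) - f ((L + R - C) / P)) * min C ((L + R - C) % P) := by
  have hP : 0 < P := by omega
  have fm : Monotone f := monotone_int_of_le_succ fmono
  have hX : 0 ≤ L + R - C := by omega
  have hN := Int.ediv_nonneg hX hP.le
  have hq := Int.emod_nonneg (L + R - C) hP.ne'
  have hq' := Int.emod_lt_of_pos (L + R - C) hP
  have hdiv := Int.mul_ediv_add_emod (L + R - C) P
  generalize (L + R - C) / P = N at *
  generalize (L + R - C) % P = q at *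
  have hfN : 0 ≤ f N := f0 ▸ fm hN
  have hmin : 0 ≤ min C q := le_min hC.le hq
  have hbase : f N * C ≤ f N * C + (f (N + 1) - f N) * min C q :=
    le_add_of_nonneg_right (mul_nonneg (sub_nonneg.2 (fmono N)) hmin)
  -- With `L + R - C = N * P + q`, the last bound reads `c₁ + c₂ ≤ C + q - (p - 1 - N) * P`. As `C ≤
  -- P` and `q < P`, positivity of `c₁` and `c₂` leaves `p ≤ N`, `p = N + 1` and `p = N + 2`.
  rcases htot with h | ⟨h1, h2⟩ | ⟨cnt, p, c₁, c₂, h1, h2, h3, h4, h5, h6, h7⟩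
  · exact (h.trans (mul_nonneg hfN hC.le)).trans hbase
  · rcases hN.eq_or_lt with rfl | hN
    · simp only [f0, zero_add, f1] at *
      omega
    · have : 1 ≤ f N := f1 ▸ fm hN
      nlinarith
  · have hcnt : total ≤ cnt * C := by linarith
    rcases le_or_gt p N with hp | hp
    · have : cnt ≤ f N := h2.trans (fm hp)
      nlinarith
    · have e : f (N + 1) = f N ∨ f (N + 1) = f N + 1 := by
        have := fmono N; have := fstep N; omega
      rcases (show N + 1 ≤ p by omega).eq_or_lt with rfl | hp
      · rcases e with e | e
        · have : cnt ≤ f N := by omega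
          nlinarith
        · have h8 : c₁ + c₂ ≤ C + min C q := by
            have : c₁ + c₂ ≤ C + q := by linarith
            omega
          have h9 : (cnt - 2) * C ≤ (f N - 1) * C :=
            mul_le_mul_of_nonneg_right (by omega) hC.le
          rw [e]; linarith
      · rcases (show N + 2 ≤ p by omega).eq_or_lt with rfl | hp
        · have h8 : c₁ + c₂ ≤ C + q - P := by linarith
          have h10 := fstep (N + 1)
          rw [add_assoc] at h10
          norm_num at h10
          rcases e with e | e
          · have h9 : (cnt - 2) * C ≤ (f N - 1) * C :=
              mul_le_mul_of_nonneg_right (by omega) hC.le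
            linarith
          · have h9 : (cnt - 2) * C ≤ f N * C :=
              mul_le_mul_of_nonneg_right (by omega) hC.le
            have : c₁ + c₂ ≤ min C q := by omega
            rw [e]; linarith
        · exfalso
          have : (N + 2) * P ≤ (p - 1) * P := mul_le_mul_of_nonneg_right (by omega) hP.le
          linarith

/-! ### The workload formula as a count of top-class jobs -/

namespace WHTask

/-- The largest number of jobs of the top class among `p` consecutive jobs (for low-tolerance
tasks), and among `p` blocks of `w + 1` consecutive jobs (for high-tolerance tasks). -/
def maxTop (τ : WHTask) (p : ℤ) : ℤ :=
  if τ.HighTolerance then p else p - p / ((τ.h : ℤ) + 1)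

/-- The quotient increases exactly when the remainder is `h`, its maximal value; dividing the
remainder by `h` is the indicator of this event. -/
theorem succ_ediv_eq (τ : WHTask) (p : ℤ) :
    (p + 1) / ((τ.h : ℤ) + 1) = p / ((τ.h : ℤ) + 1) + (p % ((τ.h : ℤ) + 1)) / (τ.h : ℤ) := by
  have hh : (0 : ℤ) < τ.h := by exact_mod_cast τ.h_pos
  generalize (τ.h : ℤ) = h at *
  have h1 := Int.emod_nonneg p (show h + 1 ≠ 0 by omega)
  have h2 := Int.emod_lt_of_pos p (show 0 < h + 1 by omega)
  have h3 := Int.mul_ediv_add_emod p (h + 1)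
  generalize p / (h + 1) = a at *
  generalize p % (h + 1) = b at *
  subst h3
  rcases (show b ≤ h by omega).eq_or_lt with rfl | hb
  · rw [Int.ediv_self hh.ne', show (b + 1) * a + b + 1 = (b + 1) * (a + 1) by ring,
      Int.mul_ediv_cancel_left _ (by omega)]
  · rw [Int.ediv_eq_zero_of_lt h1 hb, add_assoc, add_comm, Int.add_mul_ediv_left _ _ (by omega),
      Int.ediv_eq_zero_of_lt (by omega) (by omega)]
    ring

theorem maxTop_succ_mem (τ : WHTask) (p : ℤ) :
    τ.maxTop p ≤ τ.maxTop (p + 1) ∧ τ.maxTop (p + 1) ≤ τ.maxTop p + 1 := by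
  have hh : (0 : ℤ) < τ.h := by exact_mod_cast τ.h_pos
  unfold maxTop
  split_ifs
  · omega
  · rw [succ_ediv_eq]
    have h1 := Int.emod_nonneg p (show (τ.h : ℤ) + 1 ≠ 0 by omega)
    have h2 := Int.emod_lt_of_pos p (show 0 < (τ.h : ℤ) + 1 by omega)
    have h3 : (p % ((τ.h : ℤ) + 1)) / (τ.h : ℤ) < 2 := by
      rw [Int.ediv_lt_iff_lt_mul hh]; omega
    have h4 := Int.ediv_nonneg h1 hh.le
    omega

theorem maxTop_zero (τ : WHTask) : τ.maxTop 0 = 0 := by simp [maxTop]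

theorem maxTop_one (τ : WHTask) : τ.maxTop 1 = 1 := by
  have := τ.h_pos
  unfold maxTop
  split_ifs
  · rfl
  · rw [Int.ediv_eq_zero_of_lt] <;> omega

theorem T_le_period (τ : WHTask) : (τ.T : ℤ) ≤ τ.period := by
  unfold period
  split_ifs
  · have : (0 : ℤ) ≤ τ.w * τ.T := by positivity
    linarith
  · rfl

/-- For `R ≤ D` the slack is `D - R`, so the span is `L + R - C`. Then `N - O` is `maxTop N`, and
the carry-out indicator `a` is the increment of `maxTop` at `N`. -/
theorem workload_eq (τ : WHTask) {R : ℤ} (hR : R ≤ τ.D) (L : ℤ) :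
    τ.workload R L = τ.maxTop ((L + R - τ.C) / τ.period) * τ.C +
      (τ.maxTop ((L + R - τ.C) / τ.period + 1) - τ.maxTop ((L + R - τ.C) / τ.period)) *
        min (τ.C : ℤ) ((L + R - τ.C) % τ.period) := by
  have hs : τ.span R L = L + R - τ.C := by unfold span slack; omega
  unfold workload a O maxTop N
  rw [hs]
  by_cases ht : τ.HighTolerance
  · simp [ht]
  · simp only [ht, if_false, succ_ediv_eq, period]
    rw [Int.ediv_ediv_of_nonneg (by positivity)]
    ring

theorem le_workload_of_card (τ : WHTask) {R L : ℤ} (hR : R ≤ τ.D) (hCR : τ.C ≤ R) (hL : 0 ≤ L)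
    {total : ℤ}
    (htot : total ≤ 0 ∨ (total ≤ τ.C ∧ total ≤ L) ∨ ∃ cnt p c₁ c₂ : ℤ,
      total ≤ (cnt - 2) * τ.C + c₁ + c₂ ∧ cnt ≤ τ.maxTop p ∧ 0 < c₁ ∧ 0 < c₂ ∧ c₁ ≤ τ.C ∧
      c₂ ≤ τ.C ∧ c₁ + c₂ ≤ L + R - (p - 1) * τ.period) :
    total ≤ τ.workload R L := by
  rw [τ.workload_eq hR]
  have h1 : (τ.D : ℤ) ≤ τ.T := by exact_mod_cast τ.D_le_T
  exact workload_arith τ.maxTop_zero τ.maxTop_one (fun n => (τ.maxTop_succ_mem n).1)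
    (fun n => (τ.maxTop_succ_mem n).2) (by exact_mod_cast τ.C_pos)
    (by linarith [τ.T_le_period]) hCR hL htot

theorem workload_nonneg (τ : WHTask) {R L : ℤ} (hR : R ≤ τ.D) (hCR : τ.C ≤ R) (hL : 0 ≤ L) :
    0 ≤ τ.workload R L := τ.le_workload_of_card hR hCR hL (.inl le_rfl)

end WHTask
-- Priorities of the classes and lower bound on the fixed point
namespace TaskSet

variable {n : ℕ} (S : TaskSet n)

theorem numClasses_pos (i : Fin n) : 0 < (S.task i).numClasses := Nat.succ_pos _

theorem classPriority_zero (i : Fin n) :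
    S.classPriority i 0 = (∑ j, (S.task j).numClasses) - i := by
  unfold classPriority
  congr 1
  have h1 : ∀ j : Fin n, ((Finset.range (S.task j).numClasses).filter
      (fun p => p < 0 ∨ (p = 0 ∧ j < i))).card = if j < i then 1 else 0 := by
    intro j
    have h2 := S.numClasses_pos j
    split_ifs with h
    · rw [Finset.card_eq_one]
      refine ⟨0, ?_⟩
      ext p
      simp only [Finset.mem_filter, Finset.mem_range, Finset.mem_singleton]
      omega
    · simp [h]
  rw [Finset.sum_congr rfl fun j _ => h1 j, Finset.sum_boole, Finset.filter_gt_eq_Iio, Fin.card_Iio, Nat.cast_id]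

theorem classPriority_le_of_pos (i : Fin n) {q : ℕ} (hq : 0 < q) :
    S.classPriority i q ≤ (∑ j, (S.task j).numClasses) - n := by
  unfold classPriority
  apply Nat.sub_le_sub_left
  calc n = ∑ _j : Fin n, 1 := by simp
    _ ≤ _ := Finset.sum_le_sum fun j _ => Finset.card_pos.2
      ⟨0, by simp [S.numClasses_pos j, hq]⟩

theorem lt_of_mem_hp {i k : Fin n} (h : i ∈ S.hp k) : i < k := by
  simp only [hp, Finset.mem_filter, Finset.mem_univ, true_and, classPriority_zero] at h
  rw [Fin.lt_def]
  omega

theorem hp_subset {i k : Fin n} (h : i ∈ S.hp k) : S.hp i ⊆ S.hp k := by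
  simp only [hp, Finset.mem_filter, Finset.mem_univ, true_and, Finset.subset_iff] at h ⊢
  exact fun x hx => h.trans hx

/-- All `n` top classes precede every class with `q > 0`, so only top classes can interfere with a
top class. -/
theorem eq_zero_and_mem_hp {i k : Fin n} {q : ℕ}
    (h : S.classPriority k 0 < S.classPriority i q) : q = 0 ∧ i ∈ S.hp k := by
  rcases Nat.eq_zero_or_pos q with rfl | hq
  · exact ⟨rfl, by simpa [hp] using h⟩
  · have h1 := S.classPriority_le_of_pos i hq
    rw [classPriority_zero] at h
    have := k.2
    omega

/-- Nonnegative workloads keep every iterate at or above `C`. This is the only use of the starting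
value of the iteration. -/
theorem le_of_isRub {nc : ℕ} {R : Fin n → ℤ} {k : Fin n} (hk : S.IsRub nc R k)
    (H : ∀ i ∈ S.hp k, R i ≤ (S.task i).D ∧ (S.task i).C ≤ R i) : (S.task k).C ≤ R k := by
  obtain ⟨⟨l, hl⟩, -⟩ := hk
  rw [← hl]
  clear hl
  induction l with
  | zero => simp
  | succ l ih =>
    rw [Function.iterate_succ_apply']
    generalize (S.rtaStep nc R k)^[l] ((S.task k).C : ℤ) = x at *
    refine le_add_of_nonneg_right (Int.ediv_nonneg (Finset.sum_nonneg fun i hi => ?_) (by simp))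
    obtain ⟨h1, h2⟩ := H i hi
    exact le_min ((S.task i).workload_nonneg h1 h2 (by omega)) (by omega)

end TaskSet

/-! ### Service, pending jobs and interference in a schedule -/

namespace Arrivals

variable {n : ℕ} {S : TaskSet n} (A : Arrivals S)

theorem release_add_le (i : Fin n) (j d : ℕ) (h : ((j + d : ℕ) : ℕ∞) < A.count i) :
    A.release i j + d * (S.task i).T ≤ A.release i (j + d) := by
  induction d with
  | zero => simp
  | succ d ih =>
    have h1 := ih (lt_of_le_of_lt (by exact_mod_cast (by omega : j + d ≤ j + (d + 1))) h)
    have h2 := A.separated i (j + d) h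
    rw [Nat.succ_mul, ← Nat.add_assoc j]
    omega

section Service

variable (σ : ℕ → Finset (Fin n × ℕ))

theorem service_mono (i : Fin n) (j : ℕ) : Monotone (service σ i j) := fun _ _ h =>
  Finset.card_le_card (Finset.filter_subset_filter _ (Finset.range_mono h))

theorem service_add (i : Fin n) (j a b : ℕ) : service σ i j (a + b) =
    service σ i j a + ((Finset.Ico a (a + b)).filter (fun s => (i, j) ∈ σ s)).card := by
  unfold service
  rw [Finset.range_eq_Ico, Finset.range_eq_Ico,
    ← Finset.Ico_union_Ico_eq_Ico (Nat.zero_le a) (Nat.le_add_right a b), Finset.filter_union,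
    Finset.card_union_of_disjoint]
  exact (Finset.Ico_disjoint_Ico_consecutive 0 a (a + b)).mono
    (Finset.filter_subset _ _) (Finset.filter_subset _ _)

end Service

/-- As `D ≤ T`, a job is killed or completed before its successor can be pending. -/
theorem pending_unique {σ : ℕ → Finset (Fin n × ℕ)} {i : Fin n} {j j' t : ℕ}
    (h : A.Pending σ i j t) (h' : A.Pending σ i j' t) : j = j' := by
  wlog hl : j < j' generalizing j j'
  · rcases Nat.lt_or_ge j' j with hl' | hl'
    · exact (this h' h hl').symm
    · omega
  obtain ⟨d, rfl⟩ := Nat.exists_eq_add_of_lt hl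
  obtain ⟨-, -, h1, -⟩ := h
  obtain ⟨h2, h3, -, -⟩ := h'
  have h4 := A.release_add_le i j (d + 1) h2
  rw [Nat.succ_mul, ← Nat.add_assoc j] at h4
  have := (S.task i).D_le_T
  omega

variable {A} {nc : ℕ} {consec : Bool} {σ : ℕ → Finset (Fin n × ℕ)}

theorem IsSchedule.service_le_cost (hσ : A.IsSchedule nc consec σ) (i : Fin n) (j t : ℕ) :
    service σ i j t ≤ A.cost i j := by
  induction t with
  | zero => simp [service]
  | succ t ih =>
    have h1 := service_add σ i j t 1
    by_cases h : (i, j) ∈ σ t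
    · have h2 := (hσ.pending t i j h).2.2.2
      have h3 := Finset.card_filter_le (Finset.Ico t (t + 1)) (fun s => (i, j) ∈ σ s)
      simp only [Nat.card_Ico] at h3
      omega
    · have h3 : (Finset.Ico t (t + 1)).filter (fun s => (i, j) ∈ σ s) = ∅ := by
        simp [Finset.filter_eq_empty_iff, h]
      rw [h3] at h1
      simp at h1
      omega

theorem IsSchedule.card_slots_le (hσ : A.IsSchedule nc consec σ) (i : Fin n) (j a L : ℕ) :
    ((Finset.Ico a (a + L)).filter (fun s => (i, j) ∈ σ s)).card ≤ (S.task i).C := by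
  have h1 := service_add σ i j a L
  have h2 := hσ.service_le_cost i j (a + L)
  have h3 := A.cost_le i j
  omega

theorem exists_jobClass_ne_zero {i : Fin n} {j : ℕ}
    (H : ∀ l, l ≤ j + (S.task i).h → A.jobClass consec σ i l = 0 → A.Hit σ i l) :
    ∃ l, j ≤ l ∧ l ≤ j + (S.task i).h ∧ A.jobClass consec σ i l ≠ 0 := by
  classical
  unfold jobClass at H ⊢
  obtain ⟨l, h1, h2, h3⟩ := (S.task i).exists_level_pos consec (A.Hit σ i) (j := j)
    fun l _ h2 h3 => H l h2 (by
      convert (show (max 0 ((S.task i).levelState consec (A.Hit σ i) l).1).toNat = 0 by omega))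
  refine ⟨l, h1, h2, ?_⟩
  have : (max 0 ((S.task i).levelState consec (A.Hit σ i) l).1).toNat ≠ 0 := by omega
  convert this

theorem add_le_of_jobClass_eq_zero {i : Fin n} (ht : (S.task i).HighTolerance) {j j' : ℕ}
    (H : ∀ l ≤ j, A.jobClass consec σ i l = 0 → A.Hit σ i l) (hj : A.jobClass consec σ i j = 0)
    (hj' : A.jobClass consec σ i j' = 0) (hlt : j < j') : j + ((S.task i).w + 1) ≤ j' := by
  classical
  by_contra! hc
  obtain ⟨d, rfl⟩ := Nat.exists_eq_add_of_lt hlt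
  unfold jobClass at H hj hj'
  have h1 := (S.task i).level_pos_of_level_nonpos consec (A.Hit σ i)
    ((S.task i).h_le_one_of_highTolerance ht) (j := j) (d := d)
    (fun l h2 h3 => H l h2 (by
      convert (show (max 0 ((S.task i).levelState consec (A.Hit σ i) l).1).toNat = 0 by omega)))
    (by
      have : (max 0 ((S.task i).levelState consec (A.Hit σ i) j).1).toNat = 0 := by
        convert hj
      omega) (by omega)
  have h2 : (max 0 ((S.task i).levelState consec (A.Hit σ i) (j + d + 1)).1).toNat = 0 := by
    convert hj'
  rw [show j + 1 + d = j + d + 1 by omega] at h1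
  omega

/-- The top-class workload of a task whose top-class jobs have response times at most `R`. -/
theorem IsSchedule.card_busy_le_workload (hσ : A.IsSchedule nc consec σ) (i : Fin n) {R : ℕ}
    (hR : R ≤ (S.task i).D) (hCR : (S.task i).C ≤ R)
    (H : ∀ j : ℕ, (j : ℕ∞) < A.count i → A.jobClass consec σ i j = 0 →
      A.cost i j ≤ service σ i j (A.release i j + R)) (a L : ℕ) (E : Finset ℕ)
    (hE : ∀ t ∈ E, a ≤ t ∧ t < a + L ∧ ∃ j, (i, j) ∈ σ t ∧ A.jobClass consec σ i j = 0) :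
    (E.card : ℤ) ≤ (S.task i).workload R L := by
  choose! h1 h2 g h3 h4 using hE
  set J := E.image g with hJ
  set c : ℕ → ℕ := fun j => ((Finset.Ico a (a + L)).filter (fun s => (i, j) ∈ σ s)).card with hc
  have hEc : E.card ≤ ∑ j ∈ J, c j := by
    refine le_trans (Finset.card_le_card fun t ht => ?_) Finset.card_biUnion_le
    simp only [Finset.mem_biUnion, Finset.mem_filter, Finset.mem_Ico]
    exact ⟨g t, Finset.mem_image_of_mem g ht, ⟨h1 t ht, h2 t ht⟩, h3 t ht⟩
  have hcnt : ∀ j ∈ J, (j : ℕ∞) < A.count i := by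
    intro j hj
    obtain ⟨t, ht, rfl⟩ := Finset.mem_image.1 hj
    exact (hσ.pending t i _ (h3 t ht)).1
  have htop : ∀ j ∈ J, A.jobClass consec σ i j = 0 := by
    intro j hj
    obtain ⟨t, ht, rfl⟩ := Finset.mem_image.1 hj
    exact h4 t ht
  have hpos : ∀ j ∈ J, 0 < c j := by
    intro j hj
    obtain ⟨t, ht, rfl⟩ := Finset.mem_image.1 hj
    exact Finset.card_pos.2 ⟨t, by simp [h1 t ht, h2 t ht, h3 t ht]⟩
  have hcC : ∀ j, c j ≤ (S.task i).C := fun j => hσ.card_slots_le i j a L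
  have hcI : ∀ j ∈ J,
      c j ≤ min (a + L) (A.release i j + R) - max a (A.release i j) := by
    intro j hj
    rw [← Nat.card_Ico]
    refine Finset.card_le_card fun t ht => ?_
    simp only [Finset.mem_filter, Finset.mem_Ico] at ht ⊢
    obtain ⟨-, h5, -, h6⟩ := hσ.pending t i j ht.2
    have h7 : t < A.release i j + R := by
      by_contra! h8
      exact absurd ((H j (hcnt j hj) (htop j hj)).trans (service_mono σ i j h8)) (by omega)
    omega
  have hhit : ∀ j ∈ J, ∀ l ≤ j, A.jobClass consec σ i l = 0 → A.Hit σ i l := by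
    intro j hj l hl h5
    exact (H l (lt_of_le_of_lt (by exact_mod_cast hl) (hcnt j hj)) h5).trans
      (service_mono σ i l (by omega))
  clear_value J c
  apply (S.task i).le_workload_of_card (by exact_mod_cast hR) (by exact_mod_cast hCR) (by simp)
  rcases J.eq_empty_or_nonempty with rfl | hne
  · left; simpa using hEc
  right
  have hx := J.min'_mem hne
  have hy := J.max'_mem hne
  have hmin : ∀ j ∈ J, J.min' hne ≤ j := fun j hj => J.min'_le j hj
  have hmax : ∀ j ∈ J, j ≤ J.max' hne := fun j hj => J.le_max' j hj
  generalize J.min' hne = x at *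
  generalize J.max' hne = y at *
  rcases (hmin y hy).eq_or_lt with rfl | hxy
  · left
    have : J = {x} := Finset.eq_singleton_iff_unique_mem.2
      ⟨hx, fun j hj => le_antisymm (hmax j hj) (hmin j hj)⟩
    rw [this, Finset.sum_singleton] at hEc
    have h5 := hcC x
    have h6 := hcI x hx
    omega
  right
  have hsum : (E.card : ℤ) ≤ ((J.card : ℤ) - 2) * (S.task i).C + c x + c y := by
    have hx' : x ∈ J.erase y := Finset.mem_erase.2 ⟨hxy.ne, hx⟩
    have h5 := Finset.add_sum_erase J c hy
    have h6 := Finset.add_sum_erase (J.erase y) c hx'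
    have h7 := Finset.sum_le_card_nsmul ((J.erase y).erase x) (fun j => c j) _
      fun j _ => hcC j
    have h8 := Finset.card_erase_add_one hx'
    have h9 := Finset.card_erase_add_one hy
    rw [smul_eq_mul] at h7
    have h10 : (J.card : ℤ) - 2 = ((J.erase y).erase x).card := by omega
    rw [h10]
    exact_mod_cast (by omega : E.card ≤
      ((J.erase y).erase x).card * (S.task i).C + c x + c y)
  -- For high tolerance, `p` counts the top-class jobs, whose indices are `w + 1` apart; for low
  -- tolerance, it counts all indices from `x` to `y`.
  obtain ⟨p, hp1, hp2⟩ : ∃ p : ℤ, (J.card : ℤ) ≤ (S.task i).maxTop p ∧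
      (p - 1) * (S.task i).period ≤ ((y : ℤ) - x) * (S.task i).T := by
    by_cases ht : (S.task i).HighTolerance
    · refine ⟨J.card, by simp [WHTask.maxTop, ht], ?_⟩
      have sep : ∀ u ∈ J, ∀ v ∈ J, u < v → u + ((S.task i).w + 1) ≤ v := fun u hu v hv huv =>
        add_le_of_jobClass_eq_zero ht (hhit u hu) (htop u hu) (htop v hv) huv
      have h5 := card_mul_add_le_of_separated ((S.task i).w + 1) (J.erase y)
        (fun u hu v hv => sep u (Finset.mem_of_mem_erase hu) v (Finset.mem_of_mem_erase hv)) x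
        (fun u hu => hmin u (Finset.mem_of_mem_erase hu)) y
        (fun u hu => sep u (Finset.mem_of_mem_erase hu) y hy)
        (fun u hu => lt_of_le_of_ne (hmax u (Finset.mem_of_mem_erase hu))
          (Finset.ne_of_mem_erase hu)) hxy.le
      have h9 := Finset.card_erase_add_one hy
      simp only [WHTask.period, ht, if_true]
      rw [← mul_assoc]
      refine mul_le_mul_of_nonneg_right ?_ (by simp)
      rw [← h9]
      push_cast
      zify at h5
      linarith
    · refine ⟨((y + 1 - x : ℕ) : ℤ), ?_, ?_⟩
      -- Only windows ending by `y` are used, since hits are known only for jobs up to `y`.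
      · have h5 := card_filter_Ico_le_of_exists_not (fun l => A.jobClass consec σ i l = 0)
          (S.task i).h (y + 1) (fun l hl => exists_jobClass_ne_zero
            fun l' hl' => hhit y hy l' (by omega)) (y + 1 - x) x (by omega)
        have h6 : J.card ≤
            ((Finset.Ico x (y + 1)).filter (fun l => A.jobClass consec σ i l = 0)).card :=
          Finset.card_le_card fun l hl => by
            have := hmin l hl
            have := hmax l hl
            simp only [Finset.mem_filter, Finset.mem_Ico]
            exact ⟨by omega, htop l hl⟩
        simp only [WHTask.maxTop, ht, if_false]
        generalize y + 1 - x = p at *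
        have h7 : J.card + p / ((S.task i).h + 1) ≤ p := by omega
        zify at h7
        linarith
      · simp only [WHTask.period, ht, if_false]
        exact mul_le_mul_of_nonneg_right (by omega) (by simp)
  refine ⟨J.card, p, c x, c y, hsum, hp1, by exact_mod_cast hpos x hx,
    by exact_mod_cast hpos y hy, by exact_mod_cast hcC x, by exact_mod_cast hcC y, ?_⟩
  have h5 := hcI x hx
  have h6 := hcI y hy
  have h7 := hpos x hx
  have h8 := hpos y hy
  obtain ⟨d, rfl⟩ := Nat.exists_eq_add_of_le hxy.le
  have h9 := A.release_add_le i x d (hcnt _ hy)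
  have h10 : ((x + d : ℕ) - x : ℤ) * (S.task i).T = ((d * (S.task i).T : ℕ) : ℤ) := by
    push_cast; ring
  rw [h10] at hp2
  -- The first job runs before `release x + R`, the last one not before `release y`, so the two
  -- shares sum to at most `L + R` minus the release distance. Positive shares rule out truncated
  -- subtractions.
  omega

/-- The interference suffered by a top-class job that is not completed `x` time units after its
release. -/
theorem IsSchedule.mul_le_sum_of_service_lt (hσ : A.IsSchedule nc consec σ) {k : Fin n} {j x : ℕ}
    (hj : (j : ℕ∞) < A.count k) (hclass : A.jobClass consec σ k j = 0)
    (hx : x ≤ (S.task k).D) (hCx : (S.task k).C ≤ x)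
    (hserv : service σ k j (A.release k j + x) < A.cost k j) {W : Fin n → ℤ}
    (hW : ∀ i ∈ S.hp k, ∀ E : Finset ℕ, (∀ t ∈ E, A.release k j ≤ t ∧ t < A.release k j + x ∧
      ∃ l, (i, l) ∈ σ t ∧ A.jobClass consec σ i l = 0) → (E.card : ℤ) ≤ W i) :
    (nc : ℤ) * ((x : ℤ) - (S.task k).C + 1) ≤
      ∑ i ∈ S.hp k, min (W i) ((x : ℤ) - (S.task k).C + 1) := by
  classical
  -- The job runs in at most `C - 1` of the `x` slots. The waiting slots are trimmed to exactly `x -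
  -- C + 1`, which yields the cap inside the minimum.
  have hpend : ∀ t, A.release k j ≤ t → t < A.release k j + x → A.Pending σ k j t :=
    fun t h1 h2 => ⟨hj, h1, by omega, (service_mono σ k j h2.le).trans_lt hserv⟩
  obtain ⟨B, hB, hBcard⟩ : ∃ B ⊆ (Finset.Ico (A.release k j) (A.release k j + x)).filter
      (fun t => (k, j) ∉ σ t), B.card = x - (S.task k).C + 1 := by
    apply Finset.exists_subset_card_eq
    have h1 := service_add σ k j (A.release k j) x
    have h2 := A.cost_le k j
    have h3 := Finset.card_filter_add_card_filter_not
      (s := Finset.Ico (A.release k j) (A.release k j + x)) (fun t => (k, j) ∈ σ t)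
    rw [Nat.card_Ico] at h3
    omega
  have hB' : ∀ t ∈ B, A.release k j ≤ t ∧ t < A.release k j + x ∧ (k, j) ∉ σ t := fun t ht => by
    have := hB ht
    simp only [Finset.mem_filter, Finset.mem_Ico] at this
    tauto
  have hprio : ∀ t ∈ B, (σ t).card = nc ∧ ∀ i l, (i, l) ∈ σ t →
      A.jobClass consec σ i l = 0 ∧ i ∈ S.hp k := by
    intro t ht
    obtain ⟨h1, h2, h3⟩ := hB' t ht
    obtain ⟨h4, h5⟩ := hσ.priority t k j (hpend t h1 h2) h3
    refine ⟨h4, fun i l hil => S.eq_zero_and_mem_hp ?_⟩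
    have := h5 i l hil
    rwa [hclass] at this
  set F : Fin n → Finset ℕ := fun i => B.filter (fun t => ∃ l, (i, l) ∈ σ t) with hF
  have hFW : ∀ i ∈ S.hp k, ((F i).card : ℤ) ≤ min (W i) ((x : ℤ) - (S.task k).C + 1) := by
    intro i hi
    refine le_min (hW i hi _ fun t ht => ?_) ?_
    · obtain ⟨h1, l, h2⟩ := Finset.mem_filter.1 ht
      exact ⟨(hB' t h1).1, (hB' t h1).2.1, l, h2, ((hprio t h1).2 i l h2).1⟩
    · have : (F i).card ≤ B.card := Finset.card_filter_le _ _
      omega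
  refine le_trans ?_ (Finset.sum_le_sum hFW)
  have hcount : ∀ t ∈ B, nc ≤ ((S.hp k).filter (fun i => ∃ l, (i, l) ∈ σ t)).card := by
    intro t ht
    obtain ⟨h1, h2⟩ := hprio t ht
    rw [← h1]
    -- Jobs running simultaneously belong to distinct tasks, so `nc` busy cores mean at least `nc`
    -- interfering tasks.
    refine Finset.card_le_card_of_injOn Prod.fst (fun p hp => ?_) fun p hp q hq hpq => ?_
    · simp only [Finset.mem_coe, Finset.mem_filter]
      exact ⟨(h2 p.1 p.2 hp).2, p.2, hp⟩
    · obtain ⟨i, l⟩ := p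
      obtain ⟨i', l'⟩ := q
      obtain rfl : i = i' := hpq
      rw [A.pending_unique (hσ.pending t i l hp) (hσ.pending t i l' hq)]
  have hdouble : ∑ t ∈ B, ((S.hp k).filter (fun i => ∃ l, (i, l) ∈ σ t)).card =
      ∑ i ∈ S.hp k, (F i).card := by
    simp only [hF, Finset.card_filter]
    exact Finset.sum_comm
  have h1 := Finset.card_nsmul_le_sum B _ nc hcount
  rw [hdouble, hBcard, smul_eq_mul] at h1
  zify [hCx] at h1
  linarith

/-! ### Induction over priorities and conclusion -/

theorem IsSchedule.cost_le_service (hσ : A.IsSchedule nc consec σ) (hnc : 0 < nc)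
    {R : Fin n → ℤ} (k : Fin n) (hRk : S.IsRub nc R k)
    (hRhp : ∀ i ∈ S.hp k, S.IsRub nc R i ∧ R i ≤ (S.task i).D) (hRD : R k ≤ (S.task k).D) :
    ((S.task k).C : ℤ) ≤ R k ∧ ∀ j : ℕ, (j : ℕ∞) < A.count k → A.jobClass consec σ k j = 0 →
      A.cost k j ≤ service σ k j (A.release k j + (R k).toNat) := by
  induction k using WellFoundedLT.induction with
  | ind k ih =>
    have hlow : ∀ i ∈ S.hp k, ((S.task i).C : ℤ) ≤ R i ∧ ∀ j : ℕ, (j : ℕ∞) < A.count i →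
        A.jobClass consec σ i j = 0 →
        A.cost i j ≤ service σ i j (A.release i j + (R i).toNat) := fun i hi =>
      ih i (S.lt_of_mem_hp hi) (hRhp i hi).1 (fun i' hi' => hRhp i' (S.hp_subset hi hi'))
        (hRhp i hi).2
    have hCR := S.le_of_isRub hRk fun i hi => ⟨(hRhp i hi).2, (hlow i hi).1⟩
    refine ⟨hCR, fun j hj hclass => ?_⟩
    by_contra! hserv
    have hRx : ((R k).toNat : ℤ) = R k := Int.toNat_of_nonneg (by omega)
    have h1 := hσ.mul_le_sum_of_service_lt hj hclass (by omega) (by omega) hserv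
      (W := fun i => (S.task i).workload (R i) (R k)) (fun i hi E hE => by
        obtain ⟨h2, h3⟩ := hlow i hi
        have h4 := (hRhp i hi).2
        have := hσ.card_busy_le_workload i (R := (R i).toNat) (by omega) (by omega) h3 _ _ E hE
        rwa [hRx, Int.toNat_of_nonneg (by omega)] at this)
    have h2 := hRk.2
    unfold TaskSet.rtaStep at h2
    rw [hRx, mul_comm] at h1
    have h3 := (Int.le_ediv_iff_mul_le (by exact_mod_cast hnc)).2 h1
    -- The floor is at least `R k - C + 1`, so the step maps `R k` to at least `R k + 1`.
    omega

theorem IsSchedule.le_D_of_hasResponseTime (hσ : A.IsSchedule nc consec σ) {i : Fin n} {j ρ : ℕ}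
    (h : A.HasResponseTime σ i j ρ) : ρ ≤ (S.task i).D := by
  by_contra! hlt
  obtain ⟨d, rfl⟩ := Nat.exists_eq_add_of_le hlt.le
  have h1 := service_add σ i j (A.release i j + (S.task i).D) d
  have h2 : (Finset.Ico (A.release i j + (S.task i).D) (A.release i j + (S.task i).D + d)).filter
      (fun s => (i, j) ∈ σ s) = ∅ := by
    refine Finset.filter_eq_empty_iff.2 fun t ht h3 => ?_
    have := (hσ.pending t i j h3).2.2.1
    simp only [Finset.mem_Ico] at ht
    omega
  rw [h2, Finset.card_empty, Nat.add_zero, Nat.add_assoc] at h1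
  have h3 : A.cost i j ≤ service σ i j (A.release i j + ((S.task i).D + d)) := h.1
  have := h.2 (show A.cost i j ≤ service σ i j (A.release i j + (S.task i).D) from h1 ▸ h3)
  omega

end Arrivals
end WeaklyHard

theorem mainTheorem3 {n : ℕ} (S : WeaklyHard.TaskSet n) (nc : ℕ) (hnc : 0 < nc)
    (R : Fin n → ℤ) (k : Fin n)
    (hRk : S.IsRub nc R k)
    (hRhp : ∀ i ∈ S.hp k, S.IsRub nc R i ∧ R i ≤ ((S.task i).D : ℤ))
    (A : WeaklyHard.Arrivals S) (consec : Bool) (σ : ℕ → Finset (Fin n × ℕ))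
    (hσ : A.IsSchedule nc consec σ)
    (j : ℕ) (hj : (j : ℕ∞) < A.count k) (hclass : A.jobClass consec σ k j = 0) :
    (∀ ρ : ℕ, A.HasResponseTime σ k j ρ → (ρ : ℤ) ≤ R k) ∧
      (R k ≤ ((S.task k).D : ℤ) → ∃ ρ : ℕ, A.HasResponseTime σ k j ρ) := by
  have key := hσ.cost_le_service hnc k hRk hRhp
  have hnonneg : R k ≤ (S.task k).D → 0 ≤ R k := fun h =>
    (Int.natCast_nonneg _).trans (key h).1
  refine ⟨fun ρ hρ => ?_, fun h => ?_⟩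
  · rcases le_or_gt (R k) (S.task k).D with h | h
    · have h1 := hρ.2 ((key h).2 j hj hclass)
      have h2 := hnonneg h
      omega
    · have h1 := hσ.le_D_of_hasResponseTime hρ
      omega
  · have hex : ∃ x, A.cost k j ≤ WeaklyHard.Arrivals.service σ k j (A.release k j + x) :=
      ⟨_, (key h).2 j hj hclass⟩
    exact ⟨Nat.find hex, Nat.find_spec hex, fun x hx => Nat.find_min' hex hx⟩
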